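/- Let $G$ be a compact connected (smooth, finite-dimensional, real) Lie group with Lie algebra $\mathfrak g$ of left-invariant vector fields and adjoint representation $\mathrm{Ad}\colon G\to \mathrm{GL}(\mathfrak g)$, and write $\mathrm{ad}(X)Y=[X,Y]$ for $X,Y\in\mathfrak g$. Let $X_1,\dots,X_m\in\mathfrak g$, and let $(x_r,u_1^r,\dots,u_m^r)$ be a periodic trajectory of $x'=\sum_{k=1}^m u_kX_k(x)$: the controls $u_k^r\colon\mathbb R\to\mathbb R$ are $C^\infty$, the curve $x_r\colon\mathbb R\to G$ satisfies $x_r'(t)=\sum_{k} u_k^r(t)X_k(x_r(t))$ for all $t\in\mathbb R$, and $x_r,u_1^r,\dots,u_m^r$ are all $T$-periodic for some $T>0$. Assume that the trajectory is regular, i.e. $$\mathrm{span}\{\mathrm{Ad}(x_r(t))X_k \;;\; t\in\mathbb R,\ 1\le k\le m\}=\mathfrak g.$$ Define $V\colon G\to\mathbb R$ by $V(x)=\mathrm{tr}\,\mathrm{Ad}(x)$, and the auxiliary time-dependent vector field $W$ on $G$ by $$W(t,w)=\sum_{k=1}^m a_k(t,w)\,\bigl(\mathrm{Ad}(x_r(t))X_k\bigr)(w),\qquad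 a_k(t,w)=\mathrm dV\bigl((\mathrm{Ad}(x_r(t))X_k)(w)\bigr).$$ Call $w\in G$ an $\omega$-limit point of $W$ if there are an integral curve $\gamma\colon\mathbb R\to G$ of $W$ (that is, $\gamma'(t)=W(t,\gamma(t))$ for all $t$) and an increasing sequence $t_n\to\infty$ with $\gamma(t_n)\to w$, and let $\mathcal C_W=\{w\in G\;;\;W(t,w)=0\ \ \forall t\in\mathbb R\}$ be the set of critical points of $W$. If $w\in G$ is any $\omega$-limit point of $W$, then $$\mathrm{tr}\{\mathrm{Ad}(w)\cdot\mathrm{ad}(X)\}=0\quad\text{for all }X\in\mathfrak g,$$ and equivalently $\mathrm dV\,X(w)=0$ for all $X\in\mathfrak g$, i.e. $w$ is a critical point of $V$. Moreover $$\mathcal C_W=\{w\in G\;;\;\mathrm{tr}\{\mathrm{Ad}(w)\cdot\mathrm{ad}(X)\}=0\ \ \forall X\in\mathfrak g\},$$ and this set coincides both with the set of all $\omega$-limit points of $W$ and with the set of critical points of $V$. -/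

import Mathlib

open scoped Manifold ContDiff Topology

noncomputable section

namespace LieTracking

/-- A curve `γ : ℝ → M` is an integral curve of the time-dependent vector field `F`
if `γ'(t) = F (t, γ t)` for all real `t`. -/
def IsIntegralCurve {E : Type*} [NormedAddCommGroup E] [NormedSpace ℝ E]
    {M : Type*} [TopologicalSpace M] [ChartedSpace E M]
    (F : ℝ → (x : M) → TangentSpace 𝓘(ℝ, E) x) (γ : ℝ → M) : Prop :=
  ∀ t : ℝ, HasMFDerivAt 𝓘(ℝ, ℝ) 𝓘(ℝ, E) γ t ((1 : ℝ →L[ℝ] ℝ).smulRight (F t (γ t)))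

/-- The `ω`-limit set of the time-dependent vector field `F` at `(t₀, x₀)`: the limits of `γ (tₙ)`
along increasing sequences `tₙ → ∞`, for the integral curve `γ` of `F` with `γ t₀ = x₀`. -/
def omegaLimitSet {E : Type*} [NormedAddCommGroup E] [NormedSpace ℝ E]
    {M : Type*} [TopologicalSpace M] [ChartedSpace E M]
    (F : ℝ → (x : M) → TangentSpace 𝓘(ℝ, E) x) (t₀ : ℝ) (x₀ : M) : Set M :=
  {x | ∃ γ : ℝ → M, IsIntegralCurve F γ ∧ γ t₀ = x₀ ∧
    ∃ s : ℕ → ℝ, StrictMono s ∧ Filter.Tendsto s Filter.atTop Filter.atTop ∧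
      Filter.Tendsto (fun n ↦ γ (s n)) Filter.atTop (𝓝 x)}

/-- The set of all `ω`-limit points of `F`, for arbitrary initial data. -/
def omegaLimitPoints {E : Type*} [NormedAddCommGroup E] [NormedSpace ℝ E]
    {M : Type*} [TopologicalSpace M] [ChartedSpace E M]
    (F : ℝ → (x : M) → TangentSpace 𝓘(ℝ, E) x) : Set M :=
  ⋃ (t₀ : ℝ) (x₀ : M), omegaLimitSet F t₀ x₀

/-- The critical points of `F`: the points where `F (t, ·)` vanishes for all times `t`. -/
def criticalPoints {E : Type*} [NormedAddCommGroup E] [NormedSpace ℝ E]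
    {M : Type*} [TopologicalSpace M] [ChartedSpace E M]
    (F : ℝ → (x : M) → TangentSpace 𝓘(ℝ, E) x) : Set M :=
  {x | ∀ t : ℝ, F t x = 0}

section Group

variable {E : Type*} [NormedAddCommGroup E] [NormedSpace ℝ E]
  {G : Type*} [TopologicalSpace G] [ChartedSpace E G] [Group G]

variable (E) in
/-- The adjoint map `Ad E x : 𝔤 → 𝔤`, the differential at the identity of `y ↦ x * y * x⁻¹`. -/
def Ad (x : G) : GroupLieAlgebra 𝓘(ℝ, E) G →L[ℝ] GroupLieAlgebra 𝓘(ℝ, E) G :=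
  mfderiv 𝓘(ℝ, E) 𝓘(ℝ, E) (fun y : G ↦ x * y * x⁻¹) (1 : G)

variable (E) in
/-- The Lyapunov-like function `V x = tr (Ad x)`. -/
def V (x : G) : ℝ :=
  LinearMap.trace ℝ (GroupLieAlgebra 𝓘(ℝ, E) G)
    (Ad E x : GroupLieAlgebra 𝓘(ℝ, E) G →ₗ[ℝ] GroupLieAlgebra 𝓘(ℝ, E) G)

/-- The differential of `V` at `x`. -/
def dV (x : G) : TangentSpace 𝓘(ℝ, E) x →L[ℝ] ℝ :=
  mfderiv 𝓘(ℝ, E) 𝓘(ℝ, ℝ) (V E : G → ℝ) x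

variable {m : ℕ} (X : Fin m → GroupLieAlgebra 𝓘(ℝ, E) G)

/-- A smooth trajectory `(x, u₁, …, uₘ)` of the left-invariant driftless system
`x' = ∑ₖ uₖ Xₖ(x)`. -/
structure IsTrajectory (x : ℝ → G) (u : Fin m → ℝ → ℝ) : Prop where
  contDiff_control : ∀ k, ContDiff ℝ ∞ (u k)
  isIntegralCurve :
    IsIntegralCurve (fun t g ↦ ∑ k, u k t • mulInvariantVectorField (X k) g) x

/-- A `T`-periodic smooth trajectory, `T > 0`. -/
structure IsPeriodicTrajectory (T : ℝ) (x : ℝ → G) (u : Fin m → ℝ → ℝ) : Prop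
    extends IsTrajectory X x u where
  period_pos : 0 < T
  periodic_curve : Function.Periodic x T
  periodic_control : ∀ k, Function.Periodic (u k) T

/-- Regularity of a trajectory: the vectors `Ad (x t) Xₖ` span the Lie algebra. -/
def IsRegular (x : ℝ → G) : Prop :=
  Submodule.span ℝ {Y : GroupLieAlgebra 𝓘(ℝ, E) G | ∃ (t : ℝ) (k : Fin m), Y = Ad E (x t) (X k)} = ⊤

/-- The coefficients `aₖ(t, w) = dV (Ad (xᵣ t) Xₖ (w))`. -/
def auxCoeff (xr : ℝ → G) (k : Fin m) (t : ℝ) (w : G) : ℝ :=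
  dV w (mulInvariantVectorField (Ad E (xr t) (X k)) w)

/-- The auxiliary vector field `W(t, w) = ∑ₖ aₖ(t, w) Ad (xᵣ t) Xₖ (w)`. -/
def auxField (xr : ℝ → G) (t : ℝ) (w : G) : TangentSpace 𝓘(ℝ, E) w :=
  ∑ k, auxCoeff X xr k t w • mulInvariantVectorField (Ad E (xr t) (X k)) w

/-- A smooth Lie group has the regularity for which Mathlib defines the Lie bracket. -/
instance instLieGroupMinSmoothness [LieGroup 𝓘(ℝ, E) ∞ G] :
    LieGroup 𝓘(ℝ, E) (minSmoothness ℝ 3) G :=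
  LieGroup.of_le (n := ∞) (by
    rw [minSmoothness_of_isRCLikeNormedField]
    exact WithTop.coe_le_coe.2 (le_top : (3 : ℕ∞) ≤ ⊤))

/-- The trace of `Ad w ∘ ad Y`, where `ad Y Z = ⁅Y, Z⁆`. -/
def trAdad [FiniteDimensional ℝ E] [LieGroup 𝓘(ℝ, E) ∞ G] (w : G) (Y : GroupLieAlgebra 𝓘(ℝ, E) G) : ℝ :=
  haveI : CompleteSpace E := FiniteDimensional.complete ℝ E
  LinearMap.trace ℝ (GroupLieAlgebra 𝓘(ℝ, E) G)
    ((Ad E w : GroupLieAlgebra 𝓘(ℝ, E) G →ₗ[ℝ] GroupLieAlgebra 𝓘(ℝ, E) G) ∘ₗ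
      (LieAlgebra.ad ℝ (GroupLieAlgebra 𝓘(ℝ, E) G) Y))

end Group

end LieTracking

end

/-! The differential of `Ad` along a left-invariant field is `Ad w ∘ ad Y`: at the identity this is
the fact that the differential of `Ad` is `ad`, and multiplicativity of `Ad` carries it to every
`w`. Hence dV(Y(w)) = tr(Ad w ∘ ad Y), and V increases along the auxiliary field, since dV(W) = ∑ₖ
aₖ².

Let γ be an integral curve of W and A(t) = Ad(γ(t)). With Zₖ(t) = Ad(xᵣ(t)) Xₖ, which is periodic, A
solves the closed equation A' = A ∘ ad(∑ₖ aₖ Zₖ), aₖ = tr(A ∘ ad Zₖ), in a finite-dimensional vector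
space. Compactness of G bounds A, and then Barbalat's lemma applied to tr A gives aₖ → 0, so A' → 0.
If γ(sₙ) → w, each sₙ can be moved forward by less than a period to a time congruent to a prescribed
t. This changes A by o(1) and fixes the value of Zₖ at Zₖ(t). The limit is tr(Ad w ∘ ad Zₖ(t)) = 0
(`eq_zero_of_tendsto_of_bounded`), and regularity extends this from the Zₖ(t) to all of 𝔤.

Conversely, where W vanishes, dV(W) = ∑ₖ aₖ² forces every aₖ to vanish, and a constant curve at such
a point makes it an ω-limit point. -/

namespace LieTracking

/-! ### Asymptotic analysis on the real line -/

/-- **Barbalat's lemma**: if a bounded function has a nonnegative uniformly continuous derivative,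
this derivative tends to zero. -/
theorem tendsto_zero_of_hasDerivAt_of_uniformContinuous {v q : ℝ → ℝ}
    (hv : ∀ t, HasDerivAt v (q t) t) (hq : ∀ t, 0 ≤ q t) (hb : BddAbove (Set.range v))
    (huc : UniformContinuous q) : Filter.Tendsto q Filter.atTop (𝓝 0) := by
  have hmono : Monotone v := monotone_of_deriv_nonneg (fun t ↦ (hv t).differentiableAt)
    fun t ↦ by rw [(hv t).deriv]; exact hq t
  have hlim := tendsto_atTop_ciSup hmono hb
  rw [Metric.tendsto_atTop]
  intro ε hε
  obtain ⟨δ, hδ, hδ'⟩ := Metric.uniformContinuous_iff.1 huc (ε / 2) (half_pos hε)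
  -- With `h < δ`, `q` varies by less than `ε / 2` on `[t, t + h]`, while the mean value theorem
  -- yields a point there at which `q` is below `ε / 2`.
  set h := δ / 2 with hh
  have hhpos : 0 < h := half_pos hδ
  have hdiff : Filter.Tendsto (fun t ↦ v (t + h) - v t) Filter.atTop (𝓝 0) := by
    simpa using (hlim.comp (Filter.tendsto_atTop_add_const_right _ h Filter.tendsto_id)).sub hlim
  obtain ⟨N, hN⟩ := Metric.tendsto_atTop.1 hdiff (h * (ε / 2)) (by positivity)
  refine ⟨N, fun t ht ↦ ?_⟩
  obtain ⟨ξ, hξ, hξ'⟩ := exists_hasDerivAt_eq_slope v q (lt_add_of_pos_right t hhpos)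
    (fun s _ ↦ (hv s).continuousAt.continuousWithinAt) fun s _ ↦ hv s
  have h1 : q ξ < ε / 2 := by
    rw [hξ', add_sub_cancel_left, div_lt_iff₀ hhpos]
    have := hN t ht
    rw [Real.dist_0_eq_abs] at this
    linarith [le_abs_self (v (t + h) - v t)]
  have h2 : dist (q t) (q ξ) < ε / 2 := hδ' <| by
    rw [Real.dist_eq, abs_lt]
    constructor <;> linarith [hξ.1, hξ.2]
  rw [Real.dist_eq, abs_lt] at h2
  rw [Real.dist_0_eq_abs, abs_of_nonneg (hq t)]
  linarith [h2.1, h2.2]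

/-- A continuous periodic function with values in a pseudometric space is uniformly continuous. -/
theorem uniformContinuous_of_continuous_of_periodic {F : Type*} [PseudoMetricSpace F]
    {f : ℝ → F} {T : ℝ} (hT : 0 < T) (hf : Continuous f) (hper : Function.Periodic f T) :
    UniformContinuous f := by
  -- The margin of 1 on each side leaves room for the second point, which is shifted by the same
  -- multiple of `T` and lies within `min δ 1` of the first.
  have huc : UniformContinuousOn f (Set.Icc (-1) (T + 1)) :=
    isCompact_Icc.uniformContinuousOn_of_continuous hf.continuousOn
  rw [Metric.uniformContinuousOn_iff] at huc
  rw [Metric.uniformContinuous_iff]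
  intro ε hε
  obtain ⟨δ, hδ, h⟩ := huc ε hε
  refine ⟨min δ 1, by positivity, fun {a b} hab ↦ ?_⟩
  obtain ⟨n, hn⟩ : ∃ n : ℤ, a - n * T ∈ Set.Icc 0 T := by
    refine ⟨toIcoDiv hT 0 a, ?_⟩
    have := toIcoMod_mem_Ico hT 0 a
    rw [toIcoMod, zsmul_eq_mul, zero_add] at this
    exact ⟨this.1, this.2.le⟩
  have hab' := (lt_min_iff.1 hab)
  have h1 := hab'.2
  rw [Real.dist_eq, abs_lt] at h1
  rw [← hper.sub_int_mul_eq n (x := a), ← hper.sub_int_mul_eq n (x := b)]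
  refine h _ ⟨by linarith [hn.1], by linarith [hn.2]⟩ _
    ⟨by linarith [hn.1, h1.2], by linarith [hn.2, h1.1]⟩ ?_
  rw [dist_sub_right]
  exact hab'.1

/-- If the derivative of `A` tends to zero, then `A` varies little on far away intervals of bounded
length. -/
theorem tendsto_sub_zero_of_deriv_tendsto_zero {F : Type*} [NormedAddCommGroup F] [NormedSpace ℝ F]
    {A A' : ℝ → F} (hA : ∀ t, HasDerivAt A (A' t) t) (hA' : Filter.Tendsto A' Filter.atTop (𝓝 0))
    {s : ℕ → ℝ} (hs : Filter.Tendsto s Filter.atTop Filter.atTop)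
    {r : ℕ → ℝ} {T : ℝ} (hr : ∀ n, r n ∈ Set.Icc 0 T) :
    Filter.Tendsto (fun n ↦ A (s n + r n) - A (s n)) Filter.atTop (𝓝 0) := by
  have hT : 0 ≤ T := (hr 0).1.trans (hr 0).2
  rw [Metric.tendsto_atTop] at hA' ⊢
  intro ε hε
  -- Dividing by `T + 1` keeps the denominator positive when `T = 0` and makes the final bound
  -- strict.
  obtain ⟨N, hN⟩ := hA' (ε / (T + 1)) (by positivity)
  obtain ⟨M, hM⟩ := Filter.eventually_atTop.1 (hs.eventually_ge_atTop N)
  refine ⟨M, fun n hn ↦ ?_⟩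
  have key := (convex_Ici N).norm_image_sub_le_of_norm_hasDerivWithin_le (f := A) (f' := A')
    (C := ε / (T + 1)) (x := s n) (y := s n + r n) (fun t _ ↦ (hA t).hasDerivWithinAt)
    (fun t ht ↦ by simpa using (hN t ht).le) (hM n hn)
    (Set.mem_Ici.2 (by linarith [hM n hn, (hr n).1]))
  rw [dist_zero_right]
  refine key.trans_lt ?_
  rw [add_sub_cancel_left, Real.norm_of_nonneg (hr n).1]
  calc ε / (T + 1) * r n ≤ ε / (T + 1) * T := by gcongr; exact (hr n).2
    _ < ε / (T + 1) * (T + 1) := by gcongr; linarith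
    _ = ε := by field_simp

set_option maxHeartbeats 1000000 in
/-- The invariance principle for the linear equation `A' = L A Z`, `Z = ∑ₖ aₖ Zₖ`, whose
coefficients `aₖ = τ (L A Zₖ)` are such that `(τ A)' = ∑ₖ aₖ²`. -/
theorem eq_zero_of_tendsto_of_bounded {F 𝔤 : Type*} [NormedAddCommGroup F] [NormedSpace ℝ F]
    [FiniteDimensional ℝ F] [NormedAddCommGroup 𝔤] [NormedSpace ℝ 𝔤] [FiniteDimensional ℝ 𝔤]
    (L : F →L[ℝ] 𝔤 →L[ℝ] F) (τ : F →L[ℝ] ℝ) {ι : Type*} [Fintype ι] {Z : ι → ℝ → 𝔤} {T : ℝ}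
    (hT : 0 < T) (hZ : ∀ k, Continuous (Z k)) (hZT : ∀ k, Function.Periodic (Z k) T)
    {A : ℝ → F} (hAb : Bornology.IsBounded (Set.range A))
    (hA : ∀ t, HasDerivAt A (L (A t) (∑ k, τ (L (A t) (Z k t)) • Z k t)) t)
    {s : ℕ → ℝ} (hs : Filter.Tendsto s Filter.atTop Filter.atTop) {B : F}
    (hB : Filter.Tendsto (fun n ↦ A (s n)) Filter.atTop (𝓝 B)) (k : ι) (t : ℝ) :
    τ (L B (Z k t)) = 0 := by
  have := FiniteDimensional.proper ℝ F
  have := FiniteDimensional.proper ℝ 𝔤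
  have hZcomp : ∀ k, IsCompact (Set.range (Z k)) := fun k ↦ by
    rw [← (hZT k).image_Icc hT 0]
    exact isCompact_Icc.image (hZ k)
  have hAcomp : IsCompact (closure (Set.range A)) := hAb.isCompact_closure
  set a : ι → ℝ → ℝ := fun k t ↦ τ (L (A t) (Z k t)) with ha
  set b : ι → F × 𝔤 → ℝ := fun k p ↦ τ (L p.1 p.2) with hb
  have hbc : ∀ k, Continuous (b k) := fun k ↦ by simp only [hb]; fun_prop
  have hAc : Continuous A := continuous_iff_continuousAt.2 fun t ↦ (hA t).continuousAt
  have hab : ∀ k, ∃ C, ∀ t, ‖a k t‖ ≤ C := fun k ↦ by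
    obtain ⟨C, hC⟩ := (hAcomp.prod (hZcomp k)).exists_bound_of_continuousOn (hbc k).continuousOn
    exact ⟨C, fun t ↦ hC (A t, Z k t) ⟨subset_closure ⟨t, rfl⟩, t, rfl⟩⟩
  choose C hC using hab
  obtain ⟨CA, hCA⟩ := isBounded_iff_forall_norm_le.1 hAb
  have hCA' : ∀ t, ‖A t‖ ≤ CA := fun t ↦ hCA _ ⟨t, rfl⟩
  have hCA0 : 0 ≤ CA := (norm_nonneg _).trans (hCA' 0)
  have hD : ∀ k, ∃ D, ∀ t, ‖Z k t‖ ≤ D := fun k ↦ by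
    obtain ⟨D, hD⟩ := isBounded_iff_forall_norm_le.1 (hZcomp k).isBounded
    exact ⟨D, fun t ↦ hD _ ⟨t, rfl⟩⟩
  choose D hD using hD
  have hA'le : ∀ t, ‖L (A t) (∑ k, a k t • Z k t)‖ ≤ ‖L‖ * CA * ∑ k, ‖a k t‖ * D k := fun t ↦ by
    refine (L.le_opNorm₂ _ _).trans ?_
    gcongr
    · exact hCA' t
    · refine (norm_sum_le _ _).trans (Finset.sum_le_sum fun k _ ↦ ?_)
      rw [norm_smul]
      gcongr
      exact hD k t
  have hAlip : UniformContinuous A := by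
    have hD0 : ∀ k, 0 ≤ D k := fun k ↦ (norm_nonneg _).trans (hD k 0)
    have hle : ∀ t, ‖deriv A t‖ ≤ ‖L‖ * CA * ∑ k, C k * D k := fun t ↦ by
      rw [(hA t).deriv]
      refine (hA'le t).trans ?_
      gcongr with k
      · exact hD0 k
      · exact hC k t
    have h0 := (norm_nonneg _).trans (hle 0)
    exact (lipschitzWith_of_nnnorm_deriv_le (C := ⟨_, h0⟩)
      (fun t ↦ (hA t).differentiableAt) fun t ↦ hle t).uniformContinuous
  -- `a k` is the continuous function `b k`, restricted to a compact product, composed with a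
  -- uniformly continuous curve.
  have hauc : ∀ k, UniformContinuous (a k) := fun k ↦ by
    have h1 := (hAcomp.prod (hZcomp k)).uniformContinuousOn_of_continuous (hbc k).continuousOn
    have h2 : UniformContinuous fun t ↦ (A t, Z k t) :=
      hAlip.prodMk (uniformContinuous_of_continuous_of_periodic hT (hZ k) (hZT k))
    rw [← uniformContinuousOn_univ] at h2 ⊢
    exact h1.comp h2 fun t _ ↦ ⟨subset_closure ⟨t, rfl⟩, t, rfl⟩
  have hsq : UniformContinuous fun t ↦ ∑ k, a k t ^ 2 := by
    -- Squaring is uniformly continuous only on bounded sets, so the bound `C k` is needed here.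
    have hsq1 : ∀ k, UniformContinuous fun t ↦ a k t ^ 2 := fun k ↦ by
      have h1 := (isCompact_closedBall (0 : ℝ) (C k)).uniformContinuousOn_of_continuous
        (f := fun x : ℝ ↦ x ^ 2) (by fun_prop)
      have h2 := hauc k
      rw [← uniformContinuousOn_univ] at h2 ⊢
      exact h1.comp h2 fun t _ ↦ by simpa using hC k t
    have : ∀ S : Finset ι, UniformContinuous fun t ↦ ∑ k ∈ S, a k t ^ 2 := fun S ↦ by
      classical
      induction S using Finset.induction_on with
      | empty => simpa using uniformContinuous_const
      | insert k S hk ih => simpa [Finset.sum_insert hk] using (hsq1 k).add ih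
    exact this _
  have hv : ∀ t, HasDerivAt (fun t ↦ τ (A t)) (∑ k, a k t ^ 2) t := fun t ↦ by
    convert! τ.hasFDerivAt.comp_hasDerivAt t (hA t) using 1
    simp [ha, pow_two]
  have hq0 := tendsto_zero_of_hasDerivAt_of_uniformContinuous hv
    (fun t ↦ Finset.sum_nonneg fun k _ ↦ sq_nonneg _)
    (by
      refine ⟨‖τ‖ * CA, ?_⟩
      rintro _ ⟨t, rfl⟩
      exact (le_abs_self _).trans ((τ.le_opNorm _).trans (by gcongr; exact hCA' t))) hsq
  have ha0 : ∀ k, Filter.Tendsto (a k) Filter.atTop (𝓝 0) := fun k ↦ by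
    have : Filter.Tendsto (fun t ↦ a k t ^ 2) Filter.atTop (𝓝 0) :=
      squeeze_zero (fun t ↦ sq_nonneg _)
        (fun t ↦ Finset.single_le_sum (f := fun k ↦ a k t ^ 2) (fun k _ ↦ sq_nonneg _)
          (Finset.mem_univ k)) hq0
    have := this.sqrt
    simp only [Real.sqrt_sq_eq_abs, Real.sqrt_zero] at this
    exact (tendsto_zero_iff_abs_tendsto_zero _).2 this
  have hA'0 : Filter.Tendsto (fun t ↦ L (A t) (∑ k, a k t • Z k t)) Filter.atTop (𝓝 0) := by
    refine squeeze_zero_norm hA'le ?_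
    have : Filter.Tendsto (fun t ↦ ‖L‖ * CA * ∑ k, ‖a k t‖ * D k) Filter.atTop
        (𝓝 (‖L‖ * CA * ∑ k, ‖(0 : ℝ)‖ * D k)) :=
      (tendsto_finsetSum _ fun k _ ↦ (ha0 k).norm.mul_const _).const_mul _
    simpa using this
  -- The shift in `[0, T)` that makes `s n + r n` congruent to `t` modulo `T`.
  set r : ℕ → ℝ := fun n ↦ toIcoMod hT 0 (t - s n) with hr
  have hrmem : ∀ n, r n ∈ Set.Icc 0 T := fun n ↦ by
    have := toIcoMod_mem_Ico hT 0 (t - s n)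
    rw [zero_add] at this
    exact ⟨this.1, this.2.le⟩
  have hZs : ∀ n, Z k (s n + r n) = Z k t := fun n ↦ by
    have : s n + r n = t - toIcoDiv hT 0 (t - s n) * T := by
      rw [hr]
      simp only [toIcoMod, zsmul_eq_mul]
      ring
    rw [this, (hZT k).sub_int_mul_eq]
  have hBs : Filter.Tendsto (fun n ↦ A (s n + r n)) Filter.atTop (𝓝 B) := by
    simpa using (tendsto_sub_zero_of_deriv_tendsto_zero hA hA'0 hs hrmem).add hB
  have hlim : Filter.Tendsto (fun n ↦ a k (s n + r n)) Filter.atTop (𝓝 (τ (L B (Z k t)))) := by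
    simp only [ha, hZs]
    have hcont : Continuous fun M : F ↦ τ (L M (Z k t)) := by fun_prop
    exact (hcont.tendsto B).comp hBs
  exact tendsto_nhds_unique hlim ((ha0 k).comp
    (Filter.tendsto_atTop_mono (fun n ↦ by linarith [(hrmem n).1]) hs))

/-! ### Conjugation in local coordinates -/

/-- Second-order calculus behind the differential of the adjoint representation: if `P` is a local
multiplication with unit `e` and `C` the corresponding conjugation `C (u, v) = u v u⁻¹`, the
derivative of `u ↦ ∂₂ C (u, e)` at `e` is the antisymmetrization of the second derivative of `P`. -/
theorem hasFDerivAt_fderiv_conj {E : Type*} [NormedAddCommGroup E] [NormedSpace ℝ E]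
    {P C : E × E → E} {e : E} (hP : ContDiffAt ℝ ∞ P (e, e)) (hC : ContDiffAt ℝ ∞ C (e, e))
    (hPe : ∀ᶠ u in 𝓝 e, P (u, e) = u) (heP : ∀ᶠ u in 𝓝 e, P (e, u) = u)
    (hCe : ∀ᶠ u in 𝓝 e, C (u, e) = e)
    (hCP : ∀ᶠ p : E × E in 𝓝 (e, e), P (C p, p.1) = P p) :
    DifferentiableAt ℝ (fun u ↦ fderiv ℝ (fun v ↦ C (u, v)) e) e ∧ ∀ Y Z : E,
      fderiv ℝ (fun u ↦ fderiv ℝ (fun v ↦ C (u, v)) e) e Y Z =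
        VectorField.lieBracket ℝ (fun u ↦ fderiv ℝ P (u, e) (0, Y))
          (fun u ↦ fderiv ℝ P (u, e) (0, Z)) e := by
  set K : E → E →L[ℝ] E := fun u ↦ fderiv ℝ (fun v ↦ C (u, v)) e with hK
  have hKd : DifferentiableAt ℝ K e :=
    (ContDiffAt.fderiv (m := 1) (f := fun u v ↦ C (u, v)) (g := fun _ ↦ e) hC contDiffAt_const
      (by norm_cast)).differentiableAt (by simp)
  refine ⟨hKd, fun Y Z ↦ ?_⟩
  have hP' : DifferentiableAt ℝ (fderiv ℝ P) (e, e) :=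
    (hP.fderiv_right (m := 1) (by norm_cast)).differentiableAt (by simp)
  have hPd : ∀ᶠ p in 𝓝 (e, e), DifferentiableAt ℝ P p := by
    filter_upwards [(hP.of_le (m := 1) (by norm_cast)).eventually (by simp)] with p hp
      using hp.differentiableAt (by simp)
  have hCd : ∀ᶠ p in 𝓝 (e, e), DifferentiableAt ℝ C p := by
    filter_upwards [(hC.of_le (m := 1) (by norm_cast)).eventually (by simp)] with p hp
      using hp.differentiableAt (by simp)
  have hl : Filter.Tendsto (fun u : E ↦ (u, e)) (𝓝 e) (𝓝 (e, e)) :=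
    (by fun_prop : Continuous fun u : E ↦ (u, e)).tendsto e
  have hr : Filter.Tendsto (fun u : E ↦ (e, u)) (𝓝 e) (𝓝 (e, e)) :=
    (by fun_prop : Continuous fun u : E ↦ (e, u)).tendsto e
  -- the derivative of `P (C (u, v), u) = P (u, v)` with respect to `v`
  have hfirst : ∀ᶠ u in 𝓝 e, ∀ W : E,
      fderiv ℝ P (e, u) (K u W, 0) = fderiv ℝ P (u, e) (0, W) := by
    filter_upwards [hl.eventually hPd, hr.eventually hPd, hl.eventually hCd, hCe,
      hl.eventually hCP.eventually_nhds] with u h1 h2 h3 h4 h5 W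
    have i1 : HasFDerivAt (fun v : E ↦ (u, v)) (ContinuousLinearMap.inr ℝ E E) e :=
      hasFDerivAt_prodMk_right u e
    have c1 : HasFDerivAt (fun v ↦ C (u, v)) (K u) e :=
      (h3.comp e i1.differentiableAt).hasFDerivAt
    have c2 : HasFDerivAt (fun v ↦ P (C (u, v), u))
        ((fderiv ℝ P (e, u)).comp ((K u).prod 0)) e := by
      have hh : HasFDerivAt P (fderiv ℝ P (e, u)) (C (u, e), u) := by rw [h4]; exact h2.hasFDerivAt
      exact hh.comp e (c1.prodMk (hasFDerivAt_const u e))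
    have c3 : HasFDerivAt (fun v ↦ P (u, v))
        ((fderiv ℝ P (u, e)).comp (ContinuousLinearMap.inr ℝ E E)) e := h1.hasFDerivAt.comp e i1
    have hev : (fun v ↦ P (C (u, v), u)) =ᶠ[𝓝 e] fun v ↦ P (u, v) :=
      ((by fun_prop : Continuous fun v : E ↦ (u, v)).tendsto e).eventually h5
    simpa using DFunLike.congr_fun (c2.unique (c3.congr_of_eventuallyEq hev)) W
  have h1 : ∀ W, fderiv ℝ P (e, e) (W, 0) = W := fun W ↦ by
    have c : HasFDerivAt (fun u ↦ P (u, e))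
        ((fderiv ℝ P (e, e)).comp (ContinuousLinearMap.inl ℝ E E)) e :=
      HasFDerivAt.comp (f := fun u : E ↦ (u, e)) e hPd.self_of_nhds.hasFDerivAt
        (hasFDerivAt_prodMk_left e e)
    simpa using DFunLike.congr_fun
      (c.unique ((hasFDerivAt_id e).congr_of_eventuallyEq hPe)) W
  have h2 : ∀ W, fderiv ℝ P (e, e) (0, W) = W := fun W ↦ by
    have c : HasFDerivAt (fun u ↦ P (e, u))
        ((fderiv ℝ P (e, e)).comp (ContinuousLinearMap.inr ℝ E E)) e :=
      HasFDerivAt.comp (f := fun u : E ↦ (e, u)) e hPd.self_of_nhds.hasFDerivAt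
        (hasFDerivAt_prodMk_right e e)
    simpa using DFunLike.congr_fun
      (c.unique ((hasFDerivAt_id e).congr_of_eventuallyEq heP)) W
  have hKe : K e Z = Z := by
    have := hfirst.self_of_nhds Z
    rwa [h1, h2] at this
  have hR : ∀ W, HasFDerivAt (fun u ↦ fderiv ℝ P (u, e) (0, W))
      (((fderiv ℝ (fderiv ℝ P) (e, e)).comp (ContinuousLinearMap.inl ℝ E E)).flip (0, W)) e :=
    fun W ↦ by
      have := (HasFDerivAt.comp (f := fun u : E ↦ (u, e)) e hP'.hasFDerivAt
        (hasFDerivAt_prodMk_left e e)).clm_apply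
        (hasFDerivAt_const (0, W) e)
      convert! this using 1
      ext; simp
  -- Differentiating both sides of `hfirst` at `e` in direction `Y` gives K'(Y)Z + D²P((0,Y),(Z,0))
  -- = D²P((Y,0),(0,Z)), where K'(Y) is the derivative of `K` at `e` along `Y`.
  have hLft : HasFDerivAt (fun u ↦ fderiv ℝ P (e, u) (K u Z, 0))
      (((fderiv ℝ P (e, e)).comp ((ContinuousLinearMap.inl ℝ E E).comp
        ((fderiv ℝ K e).flip Z))) +
      (((fderiv ℝ (fderiv ℝ P) (e, e)).comp (ContinuousLinearMap.inr ℝ E E)).flip (K e Z, 0))) e := by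
    have hin : HasFDerivAt (fun u ↦ ((K u Z, 0) : E × E))
        ((ContinuousLinearMap.inl ℝ E E).comp ((fderiv ℝ K e).flip Z)) e := by
      have := (ContinuousLinearMap.inl ℝ E E).hasFDerivAt.comp e
        (hKd.hasFDerivAt.clm_apply (hasFDerivAt_const Z e))
      convert! this using 1
      ext <;> simp
    exact (hP'.hasFDerivAt.comp e (hasFDerivAt_prodMk_right e e)).clm_apply hin
  have heq := DFunLike.congr_fun (hLft.unique ((hR Z).congr_of_eventuallyEq
    (hfirst.mono fun u hu ↦ hu Z))) Y
  -- Symmetry turns D²P((0,Y),(Z,0)) into D²P((Z,0),(0,Y)), the second term of the bracket.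
  have hsymm : IsSymmSndFDerivAt ℝ P (e, e) := hP.isSymmSndFDerivAt
    (by rw [minSmoothness_of_isRCLikeNormedField]; norm_cast)
  simp only [hKe, add_apply, ContinuousLinearMap.comp_apply,
    ContinuousLinearMap.flip_apply, ContinuousLinearMap.inl_apply, ContinuousLinearMap.inr_apply,
    h1] at heq
  rw [VectorField.lieBracket, (hR Z).fderiv, (hR Y).fderiv, h2, h2]
  simp only [ContinuousLinearMap.comp_apply, ContinuousLinearMap.flip_apply,
    ContinuousLinearMap.inl_apply]
  rw [← heq, hsymm (Z, 0) (0, Y), add_sub_cancel_right]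

/-! ### The differential of `Ad` at the identity -/

section LieGroup

variable {E : Type*} [NormedAddCommGroup E] [NormedSpace ℝ E]
  {G : Type*} [TopologicalSpace G] [ChartedSpace E G] [Group G]

section modelDeriv

variable {F : Type*} [NormedAddCommGroup F] [NormedSpace ℝ F]
  {M : Type*} [TopologicalSpace M] [ChartedSpace E M]
  {N : Type*} [TopologicalSpace N] [ChartedSpace F N]

variable (E F) in
/-- The manifold derivative `mfderiv f x`, as a map between the model spaces. -/
noncomputable def modelDeriv (f : M → N) (x : M) : E →L[ℝ] F := mfderiv 𝓘(ℝ, E) 𝓘(ℝ, F) f x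

theorem modelDeriv_eq_fderiv {f : M → N} {x : M} (hf : MDifferentiableAt 𝓘(ℝ, E) 𝓘(ℝ, F) f x) :
    modelDeriv E F f x =
      fderiv ℝ (writtenInExtChartAt 𝓘(ℝ, E) 𝓘(ℝ, F) x f) (extChartAt 𝓘(ℝ, E) x x) := by
  rw [← fderivWithin_univ, ← ModelWithCorners.range_eq_univ 𝓘(ℝ, E)]
  exact if_pos hf

theorem modelDeriv_comp {F' : Type*} [NormedAddCommGroup F'] [NormedSpace ℝ F']
    {N' : Type*} [TopologicalSpace N'] [ChartedSpace F' N'] {g : N → N'} {f : M → N} {x : M} {y : N}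
    (hg : MDifferentiableAt 𝓘(ℝ, F) 𝓘(ℝ, F') g y) (hf : MDifferentiableAt 𝓘(ℝ, E) 𝓘(ℝ, F) f x)
    (hy : f x = y) :
    modelDeriv E F' (g ∘ f) x = (modelDeriv F F' g y).comp (modelDeriv E F f x) := by
  subst hy
  exact mfderiv_comp x hg hf

end modelDeriv

variable (E G) in
/-- The multiplication of `G` read in the preferred chart at the identity. -/
noncomputable def chartMul (p : E × E) : E :=
  extChartAt 𝓘(ℝ, E) (1 : G)
    ((extChartAt 𝓘(ℝ, E) (1 : G)).symm p.1 * (extChartAt 𝓘(ℝ, E) (1 : G)).symm p.2)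

variable (E G) in
/-- The conjugation of `G` read in the preferred chart at the identity. -/
noncomputable def chartConj (p : E × E) : E :=
  extChartAt 𝓘(ℝ, E) (1 : G)
    ((extChartAt 𝓘(ℝ, E) (1 : G)).symm p.1 * (extChartAt 𝓘(ℝ, E) (1 : G)).symm p.2 *
      ((extChartAt 𝓘(ℝ, E) (1 : G)).symm p.1)⁻¹)

variable [LieGroup 𝓘(ℝ, E) ∞ G]

theorem contMDiffAt_extChartAt_one_symm :
    ContMDiffAt 𝓘(ℝ, E) 𝓘(ℝ, E) ∞ (extChartAt 𝓘(ℝ, E) (1 : G)).symm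
      (extChartAt 𝓘(ℝ, E) (1 : G) 1) :=
  (contMDiffOn_extChartAt_symm (n := ∞) (1 : G)).contMDiffAt (extChartAt_target_mem_nhds 1)

theorem contMDiffAt_extChartAt_one_symm_fst_snd :
    ContMDiffAt 𝓘(ℝ, E × E) 𝓘(ℝ, E) ∞ (fun p : E × E ↦ (extChartAt 𝓘(ℝ, E) (1 : G)).symm p.1)
      (extChartAt 𝓘(ℝ, E) (1 : G) 1, extChartAt 𝓘(ℝ, E) (1 : G) 1) ∧
    ContMDiffAt 𝓘(ℝ, E × E) 𝓘(ℝ, E) ∞ (fun p : E × E ↦ (extChartAt 𝓘(ℝ, E) (1 : G)).symm p.2)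
      (extChartAt 𝓘(ℝ, E) (1 : G) 1, extChartAt 𝓘(ℝ, E) (1 : G) 1) :=
  ⟨ContMDiffAt.comp (f := Prod.fst) (extChartAt 𝓘(ℝ, E) (1 : G) 1, extChartAt 𝓘(ℝ, E) (1 : G) 1)
    contMDiffAt_extChartAt_one_symm contDiffAt_fst.contMDiffAt,
  ContMDiffAt.comp (f := Prod.snd) (extChartAt 𝓘(ℝ, E) (1 : G) 1, extChartAt 𝓘(ℝ, E) (1 : G) 1)
    contMDiffAt_extChartAt_one_symm contDiffAt_snd.contMDiffAt⟩

theorem contDiffAt_chartMul :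
    ContDiffAt ℝ ∞ (chartMul E G)
      (extChartAt 𝓘(ℝ, E) (1 : G) 1, extChartAt 𝓘(ℝ, E) (1 : G) 1) := by
  obtain ⟨h1, h2⟩ := contMDiffAt_extChartAt_one_symm_fst_snd (E := E) (G := G)
  exact (ContMDiffAt.comp_of_eq (y := 1) (g := extChartAt 𝓘(ℝ, E) (1 : G))
    contMDiffAt_extChartAt (h1.mul h2) (by simp)).contDiffAt

theorem contDiffAt_chartConj :
    ContDiffAt ℝ ∞ (chartConj E G)
      (extChartAt 𝓘(ℝ, E) (1 : G) 1, extChartAt 𝓘(ℝ, E) (1 : G) 1) := by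
  obtain ⟨h1, h2⟩ := contMDiffAt_extChartAt_one_symm_fst_snd (E := E) (G := G)
  exact (ContMDiffAt.comp_of_eq (y := 1) (g := extChartAt 𝓘(ℝ, E) (1 : G))
    contMDiffAt_extChartAt ((h1.mul h2).mul h1.inv) (by simp)).contDiffAt

omit [LieGroup 𝓘(ℝ, E) ∞ G] in
theorem chartConj_left (u : E) :
    chartConj E G (u, extChartAt 𝓘(ℝ, E) (1 : G) 1) = extChartAt 𝓘(ℝ, E) (1 : G) 1 := by
  simp [chartConj]

omit [LieGroup 𝓘(ℝ, E) ∞ G] in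
theorem eventually_chartMul_left :
    ∀ᶠ u in 𝓝 (extChartAt 𝓘(ℝ, E) (1 : G) 1),
      chartMul E G (u, extChartAt 𝓘(ℝ, E) (1 : G) 1) = u := by
  filter_upwards [extChartAt_target_mem_nhds (I := 𝓘(ℝ, E)) (1 : G)] with u hu
  simp only [chartMul, extChartAt_to_inv, mul_one]
  exact (extChartAt 𝓘(ℝ, E) (1 : G)).right_inv hu

omit [LieGroup 𝓘(ℝ, E) ∞ G] in
theorem eventually_chartMul_right :
    ∀ᶠ u in 𝓝 (extChartAt 𝓘(ℝ, E) (1 : G) 1),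
      chartMul E G (extChartAt 𝓘(ℝ, E) (1 : G) 1, u) = u := by
  filter_upwards [extChartAt_target_mem_nhds (I := 𝓘(ℝ, E)) (1 : G)] with u hu
  simp only [chartMul, extChartAt_to_inv, one_mul]
  exact (extChartAt 𝓘(ℝ, E) (1 : G)).right_inv hu

/-- This is (u v u⁻¹) u = u v, which determines conjugation without differentiating the inverse. It
holds only near the unit, where u v u⁻¹ stays in the chart domain. -/
theorem eventually_chartMul_chartConj :
    ∀ᶠ p in 𝓝 (extChartAt 𝓘(ℝ, E) (1 : G) 1, extChartAt 𝓘(ℝ, E) (1 : G) 1),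
      chartMul E G (chartConj E G p, p.1) = chartMul E G p := by
  have hG := topologicalGroup_of_lieGroup (I := 𝓘(ℝ, E)) (n := ∞) (G := G)
  have hc : ContinuousAt (extChartAt 𝓘(ℝ, E) (1 : G)).symm (extChartAt 𝓘(ℝ, E) (1 : G) 1) :=
    continuousAt_extChartAt_symm 1
  have h1 := ContinuousAt.comp (f := Prod.fst)
    (x := (extChartAt 𝓘(ℝ, E) (1 : G) 1, extChartAt 𝓘(ℝ, E) (1 : G) 1)) hc continuousAt_fst
  have h2 := ContinuousAt.comp (f := Prod.snd)
    (x := (extChartAt 𝓘(ℝ, E) (1 : G) 1, extChartAt 𝓘(ℝ, E) (1 : G) 1)) hc continuousAt_snd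
  have h3 := ((h1.mul h2).mul h1.inv).eventually
    ((isOpen_extChartAt_source (I := 𝓘(ℝ, E)) (1 : G)).eventually_mem (by simp))
  filter_upwards [h3] with p hp
  change (extChartAt 𝓘(ℝ, E) (1 : G)).symm p.1 * (extChartAt 𝓘(ℝ, E) (1 : G)).symm p.2 *
    ((extChartAt 𝓘(ℝ, E) (1 : G)).symm p.1)⁻¹ ∈ _ at hp
  simp only [chartMul, chartConj]
  rw [(extChartAt 𝓘(ℝ, E) (1 : G)).left_inv hp, inv_mul_cancel_right]

variable (E) in
/-- `Ad x` as a continuous endomorphism of the model space. -/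
noncomputable def adMap (x : G) : E →L[ℝ] E := modelDeriv E E (fun y : G ↦ x * y * x⁻¹) (1 : G)

theorem mdifferentiableAt_conj (x : G) (y : G) :
    MDifferentiableAt 𝓘(ℝ, E) 𝓘(ℝ, E) (fun y : G ↦ x * y * x⁻¹) y :=
  ((contMDiff_mul_right (I := 𝓘(ℝ, E)) (n := ∞) (a := x⁻¹)).comp
    (contMDiff_mul_left (I := 𝓘(ℝ, E)) (n := ∞) (a := x))).mdifferentiableAt (by simp)

theorem mdifferentiableAt_mul_left (x : G) (y : G) :
    MDifferentiableAt 𝓘(ℝ, E) 𝓘(ℝ, E) (fun y : G ↦ x * y) y :=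
  (contMDiff_mul_left (I := 𝓘(ℝ, E)) (n := ∞) (a := x)).mdifferentiableAt (by simp)

/-- `Ad x` read in the preferred chart at the identity. -/
theorem adMap_eq_fderiv (x : G) :
    adMap E x = fderiv ℝ (fun v ↦ extChartAt 𝓘(ℝ, E) (1 : G)
      (x * (extChartAt 𝓘(ℝ, E) (1 : G)).symm v * x⁻¹)) (extChartAt 𝓘(ℝ, E) (1 : G) 1) := by
  rw [adMap, modelDeriv_eq_fderiv (mdifferentiableAt_conj x 1)]
  simp only [writtenInExtChartAt, mul_one, mul_inv_cancel]
  rfl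

theorem adMap_mul (x y : G) : adMap E (x * y) = (adMap E x).comp (adMap E y) := by
  rw [adMap, adMap, adMap, ← modelDeriv_comp (mdifferentiableAt_conj x 1)
    (mdifferentiableAt_conj y 1) (by simp)]
  congr 1
  ext z
  simp [mul_assoc]

theorem differentiableAt_adMap_chart :
    DifferentiableAt ℝ ((adMap E : G → E →L[ℝ] E) ∘ (extChartAt 𝓘(ℝ, E) (1 : G)).symm)
      (extChartAt 𝓘(ℝ, E) (1 : G) 1) ∧ ∀ Y Z : E,
    fderiv ℝ ((adMap E : G → E →L[ℝ] E) ∘ (extChartAt 𝓘(ℝ, E) (1 : G)).symm)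
      (extChartAt 𝓘(ℝ, E) (1 : G) 1) Y Z =
    VectorField.lieBracket ℝ
      (fun u ↦ fderiv ℝ (chartMul E G) (u, extChartAt 𝓘(ℝ, E) (1 : G) 1) (0, Y))
      (fun u ↦ fderiv ℝ (chartMul E G) (u, extChartAt 𝓘(ℝ, E) (1 : G) 1) (0, Z))
      (extChartAt 𝓘(ℝ, E) (1 : G) 1) := by
  have hK : (fun u ↦ fderiv ℝ (fun v ↦ chartConj E G (u, v)) (extChartAt 𝓘(ℝ, E) (1 : G) 1)) =
      (adMap E : G → E →L[ℝ] E) ∘ (extChartAt 𝓘(ℝ, E) (1 : G)).symm := by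
    ext1 u
    rw [Function.comp_apply, adMap_eq_fderiv]
    rfl
  rw [← hK]
  exact hasFDerivAt_fderiv_conj (contDiffAt_chartMul (E := E) (G := G))
    contDiffAt_chartConj eventually_chartMul_left eventually_chartMul_right
    (Filter.Eventually.of_forall chartConj_left) eventually_chartMul_chartConj

theorem mdifferentiableAt_adMap_one :
    MDifferentiableAt 𝓘(ℝ, E) 𝓘(ℝ, E →L[ℝ] E) (adMap E : G → E →L[ℝ] E) 1 := by
  have h1 : MDifferentiableAt 𝓘(ℝ, E) 𝓘(ℝ, E →L[ℝ] E)
      (((adMap E : G → E →L[ℝ] E) ∘ (extChartAt 𝓘(ℝ, E) (1 : G)).symm) ∘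
        extChartAt 𝓘(ℝ, E) (1 : G)) 1 :=
    differentiableAt_adMap_chart.1.mdifferentiableAt.comp 1
      (mdifferentiableAt_extChartAt (mem_chart_source E 1))
  refine h1.congr_of_eventuallyEq ?_
  filter_upwards [extChartAt_source_mem_nhds (I := 𝓘(ℝ, E)) (1 : G)] with x hx
  simp only [Function.comp_apply, (extChartAt 𝓘(ℝ, E) (1 : G)).left_inv hx]

/-- Left-invariant vector fields read in the preferred chart at the identity. -/
theorem eventually_mpullback_mulInvariantVectorField (Y : E) :
    VectorField.mpullbackWithin 𝓘(ℝ, E) 𝓘(ℝ, E) (extChartAt 𝓘(ℝ, E) (1 : G)).symm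
      (mulInvariantVectorField (I := 𝓘(ℝ, E)) (G := G) Y) (Set.range 𝓘(ℝ, E))
      =ᶠ[𝓝 (extChartAt 𝓘(ℝ, E) (1 : G) 1)]
    fun u ↦ fderiv ℝ (chartMul E G) (u, extChartAt 𝓘(ℝ, E) (1 : G) 1) ((0, Y) : E × E) := by
  have hev : ∀ᶠ p in 𝓝 (extChartAt 𝓘(ℝ, E) (1 : G) 1, extChartAt 𝓘(ℝ, E) (1 : G) 1),
      DifferentiableAt ℝ (chartMul E G) p := by
    filter_upwards [(contDiffAt_chartMul.of_le (m := 1) (by norm_cast)).eventually (by simp)]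
      with p hp using hp.differentiableAt (by simp)
  have hl : Continuous fun u : E ↦ (u, extChartAt 𝓘(ℝ, E) (1 : G) 1) := by fun_prop
  filter_upwards [extChartAt_target_mem_nhds (I := 𝓘(ℝ, E)) (1 : G),
    (hl.tendsto _).eventually hev] with u hu hd
  -- The inverse of the differential of the inverse chart is the differential of the chart, so the
  -- pullback is the derivative at `1` of left multiplication read in the chart.
  rw [VectorField.mpullbackWithin_apply, ContinuousLinearMap.inverse_eq
    (mfderivWithin_extChartAt_symm_comp_mfderiv_extChartAt hu)
    (mfderiv_extChartAt_comp_mfderivWithin_extChartAt_symm hu)]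
  have hs : (extChartAt 𝓘(ℝ, E) (1 : G)).symm u ∈ (chartAt E (1 : G)).source := by
    simpa using (extChartAt 𝓘(ℝ, E) (1 : G)).map_target hu
  have hx := mdifferentiableAt_extChartAt (I := 𝓘(ℝ, E)) hs
  have hm := mdifferentiableAt_mul_left (E := E) ((extChartAt 𝓘(ℝ, E) (1 : G)).symm u) 1
  change (modelDeriv E E (extChartAt 𝓘(ℝ, E) (1 : G)) ((extChartAt 𝓘(ℝ, E) (1 : G)).symm u))
    (modelDeriv E E (fun y : G ↦ (extChartAt 𝓘(ℝ, E) (1 : G)).symm u * y) 1 Y) = _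
  rw [← ContinuousLinearMap.comp_apply, ← modelDeriv_comp hx hm (mul_one _), modelDeriv_eq_fderiv]
  · have hc := HasFDerivAt.comp (f := fun v : E ↦ (u, v)) _ hd.hasFDerivAt
      (hasFDerivAt_prodMk_right u _)
    have := hc.fderiv
    rw [← ContinuousLinearMap.inr_apply (R := ℝ) (M₁ := E), ← ContinuousLinearMap.comp_apply, ← this]
    rfl
  · exact MDifferentiableAt.comp (g := extChartAt 𝓘(ℝ, E) (1 : G)) _ (by rwa [mul_one]) hm

/-- The differential of `Ad` at the identity is `ad`. -/
theorem modelDeriv_adMap_one (Y Z : E) :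
    modelDeriv E (E →L[ℝ] E) (adMap E : G → E →L[ℝ] E) 1 Y Z =
      Bracket.bracket (L := GroupLieAlgebra 𝓘(ℝ, E) G) (M := GroupLieAlgebra 𝓘(ℝ, E) G) Y Z := by
  rw [modelDeriv_eq_fderiv mdifferentiableAt_adMap_one]
  refine ((differentiableAt_adMap_chart (E := E) (G := G)).2 Y Z).trans ?_
  change _ = VectorField.mlieBracket 𝓘(ℝ, E) (mulInvariantVectorField (I := 𝓘(ℝ, E)) (G := G) Y)
    (mulInvariantVectorField (I := 𝓘(ℝ, E)) (G := G) Z) (1 : G)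
  -- The chart at `1` has identity differential at its own base point, so the bracket on `G` is the
  -- bracket of the coordinate fields.
  rw [VectorField.mlieBracket, VectorField.mlieBracketWithin_apply,
    mfderiv_extChartAt_self]
  rw [Set.preimage_univ, Set.univ_inter]
  refine Eq.trans ?_ (DFunLike.congr_fun (ContinuousLinearMap.inverse_id (R := ℝ) (M := E)) _).symm
  have h := Filter.EventuallyEq.lieBracket_vectorField_eq (𝕜 := ℝ)
    (eventually_mpullback_mulInvariantVectorField (E := E) (G := G) Y)
    (eventually_mpullback_mulInvariantVectorField (G := G) Z)
  have hrange : ∀ (v w : E → E) (x : E), VectorField.lieBracket ℝ v w x =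
      VectorField.lieBracketWithin ℝ v w (Set.range 𝓘(ℝ, E)) x := fun v w x ↦ by
    rw [← VectorField.lieBracketWithin_univ, ModelWithCorners.range_eq_univ 𝓘(ℝ, E)]
  exact h.symm.trans (hrange _ _ _)

end LieGroup

/-! ### Differentials of `Ad` and `V` at arbitrary points -/

section LieGroup

variable {E : Type*} [NormedAddCommGroup E] [NormedSpace ℝ E]
  {G : Type*} [TopologicalSpace G] [ChartedSpace E G] [Group G] [LieGroup 𝓘(ℝ, E) ∞ G]

theorem adMap_comp_mul_left (w : G) :
    (adMap E : G → E →L[ℝ] E) ∘ (fun y ↦ w * y) =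
      (ContinuousLinearMap.compL ℝ E E E (adMap E w)) ∘ adMap E := by
  ext1 y
  simp [adMap_mul]

theorem mdifferentiableAt_adMap (w : G) :
    MDifferentiableAt 𝓘(ℝ, E) 𝓘(ℝ, E →L[ℝ] E) (adMap E : G → E →L[ℝ] E) w := by
  have h1 : MDifferentiableAt 𝓘(ℝ, E) 𝓘(ℝ, E →L[ℝ] E)
      (((ContinuousLinearMap.compL ℝ E E E (adMap E w)) ∘ adMap E) ∘ fun y : G ↦ w⁻¹ * y) w := by
    refine MDifferentiableAt.comp w ?_ (mdifferentiableAt_mul_left w⁻¹ w)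
    refine MDifferentiableAt.comp _
      (ContinuousLinearMap.differentiableAt _).mdifferentiableAt ?_
    rw [inv_mul_cancel]
    exact mdifferentiableAt_adMap_one
  convert! h1 using 1
  rw [← adMap_comp_mul_left]
  ext1 y
  simp

theorem continuous_adMap : Continuous (adMap E : G → E →L[ℝ] E) :=
  continuous_iff_continuousAt.2 fun w ↦ (mdifferentiableAt_adMap w).continuousAt

variable (E G) in
/-- The bilinear map `(M, Y) ↦ M ∘ ad Y`. -/
noncomputable def compAd : (E →L[ℝ] E) →L[ℝ] E →L[ℝ] E →L[ℝ] E :=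
  ((ContinuousLinearMap.compL ℝ E E E).flip.comp
    (modelDeriv E (E →L[ℝ] E) (adMap E : G → E →L[ℝ] E) 1)).flip

/-- Differentiate Ad(w y) = Ad(w) Ad(y) in y at the identity. -/
theorem modelDeriv_adMap (w : G) (Y : E) :
    modelDeriv E (E →L[ℝ] E) (adMap E : G → E →L[ℝ] E) w
      (mulInvariantVectorField (I := 𝓘(ℝ, E)) (G := G) Y w) = compAd E G (adMap E w) Y := by
  have h1 := modelDeriv_comp (mdifferentiableAt_adMap w) (mdifferentiableAt_mul_left (E := E) w 1)
    (mul_one w)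
  have h2 := modelDeriv_comp (ContinuousLinearMap.differentiableAt
    (ContinuousLinearMap.compL ℝ E E E (adMap E w)) (x := adMap E (1 : G))).mdifferentiableAt
    (mdifferentiableAt_adMap (1 : G)) rfl
  have h3 : modelDeriv (E →L[ℝ] E) (E →L[ℝ] E) (ContinuousLinearMap.compL ℝ E E E (adMap E w))
      (adMap E (1 : G)) = ContinuousLinearMap.compL ℝ E E E (adMap E w) :=
    ContinuousLinearMap.mfderiv_eq _
  rw [adMap_comp_mul_left, h2, h3] at h1
  exact (DFunLike.congr_fun h1 Y).symm

omit [Group G] [LieGroup 𝓘(ℝ, E) ∞ G] in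
theorem continuous_of_isIntegralCurve {F : ℝ → (x : G) → TangentSpace 𝓘(ℝ, E) x} {γ : ℝ → G}
    (hγ : IsIntegralCurve F γ) : Continuous γ :=
  continuous_iff_continuousAt.2 fun t ↦ (hγ t).continuousAt

/-- Through `Ad`, the flow on `G` becomes a linear-type equation on endomorphisms, to which the
invariance principle above applies. -/
theorem hasDerivAt_adMap_comp {F : ℝ → (x : G) → TangentSpace 𝓘(ℝ, E) x} {γ : ℝ → G}
    (hγ : IsIntegralCurve F γ) {t : ℝ} {Y : E}
    (hY : F t (γ t) = mulInvariantVectorField (I := 𝓘(ℝ, E)) (G := G) Y (γ t)) :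
    HasDerivAt (fun s ↦ adMap E (γ s)) (compAd E G (adMap E (γ t)) Y) t := by
  have h : HasFDerivAt (fun s ↦ adMap E (γ s))
      ((modelDeriv E (E →L[ℝ] E) (adMap E : G → E →L[ℝ] E) (γ t)).comp
        ((1 : ℝ →L[ℝ] ℝ).smulRight (M₂ := E) (F t (γ t)))) t :=
    (HasMFDerivAt.comp t (mdifferentiableAt_adMap (E := E) (γ t)).hasMFDerivAt (hγ t)).hasFDerivAt
  rw [← modelDeriv_adMap, ← hY]
  convert! h.hasDerivAt using 1
  change _ = modelDeriv E (E →L[ℝ] E) (adMap E : G → E →L[ℝ] E) (γ t) ((1 : ℝ) • (F t (γ t) : E))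
  rw [one_smul]

variable [FiniteDimensional ℝ E]

variable (E) in
/-- The trace of continuous endomorphisms, as a continuous linear form. -/
noncomputable def traceCLM : (E →L[ℝ] E) →L[ℝ] ℝ :=
  LinearMap.toContinuousLinearMap ((LinearMap.trace ℝ E) ∘ₗ ContinuousLinearMap.coeLM ℝ)

theorem dV_mulInvariantVectorField (w : G) (Y : E) :
    dV w (mulInvariantVectorField (I := 𝓘(ℝ, E)) (G := G) Y w) =
      traceCLM E (compAd E G (adMap E w) Y) := by
  have h := modelDeriv_comp ((traceCLM E).differentiableAt (x := adMap E w)).mdifferentiableAt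
    (mdifferentiableAt_adMap w) rfl
  have h3 : modelDeriv (E →L[ℝ] E) ℝ (traceCLM E) (adMap E w) = traceCLM E :=
    ContinuousLinearMap.mfderiv_eq _
  rw [h3] at h
  rw [← modelDeriv_adMap]
  exact DFunLike.congr_fun h _

/-- `compAd` is built from the differential of `Ad`, not from the bracket; `modelDeriv_adMap_one`
identifies the two. -/
theorem trAdad_eq (w : G) (Y : E) :
    trAdad (E := E) w Y = traceCLM E (compAd E G (adMap E w) Y) := by
  have := FiniteDimensional.complete ℝ E
  change LinearMap.trace ℝ E _ = LinearMap.trace ℝ E _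
  congr 1
  ext Z
  change adMap E w _ = adMap E w _
  congr 1
  exact (modelDeriv_adMap_one Y Z).symm

theorem auxField_eq {m : ℕ} (X : Fin m → GroupLieAlgebra 𝓘(ℝ, E) G) (xr : ℝ → G) (t : ℝ) (w : G) :
    auxField X xr t w = mulInvariantVectorField (I := 𝓘(ℝ, E)) (G := G)
      (∑ k, (traceCLM E (compAd E G (adMap E w) (adMap E (xr t) (X k)))) • adMap E (xr t) (X k) : E)
      w := by
  change _ = modelDeriv E E (fun y ↦ w * y) 1 _
  rw [map_sum]
  refine Finset.sum_congr rfl fun k _ ↦ ?_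
  rw [map_smul]
  change auxCoeff X xr k t w • _ = _
  rw [← dV_mulInvariantVectorField]
  rfl

-- The differential of left translation by `w` is inverted by that of `w⁻¹`.
omit [FiniteDimensional ℝ E] in
theorem surjective_mulInvariantVectorField (w : G) (ξ : TangentSpace 𝓘(ℝ, E) w) :
    ∃ Y : GroupLieAlgebra 𝓘(ℝ, E) G, mulInvariantVectorField Y w = ξ := by
  have h := modelDeriv_comp (mdifferentiableAt_mul_left (E := E) w 1)
    (mdifferentiableAt_mul_left (E := E) w⁻¹ w) (inv_mul_cancel w)
  have h1 : (fun y ↦ w * y) ∘ (fun y ↦ w⁻¹ * y) = id := by ext; simp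
  have h2 : modelDeriv E E (id : G → G) w = ContinuousLinearMap.id ℝ E := mfderiv_id
  rw [h1, h2] at h
  exact ⟨modelDeriv E E (fun y ↦ w⁻¹ * y) w ξ, (DFunLike.congr_fun h ξ).symm⟩

omit [FiniteDimensional ℝ E] in
theorem dV_eq_zero_iff (w : G) :
    (dV w : TangentSpace 𝓘(ℝ, E) w →L[ℝ] ℝ) = 0 ↔
      ∀ Y : GroupLieAlgebra 𝓘(ℝ, E) G, dV w (mulInvariantVectorField Y w) = 0 := by
  refine ⟨fun h Y ↦ by rw [h]; rfl, fun h ↦ ?_⟩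
  ext ξ
  obtain ⟨Y, rfl⟩ := surjective_mulInvariantVectorField w ξ
  exact h Y

/-! ### Regularity, critical points and ω-limit points -/

omit [LieGroup 𝓘(ℝ, E) ∞ G] in
/-- For a regular curve, a linear form vanishing on all `Ad (x t) Xₖ` is zero. -/
theorem IsRegular.forall_eq_zero {m : ℕ} {X : Fin m → GroupLieAlgebra 𝓘(ℝ, E) G} {xr : ℝ → G}
    (hreg : IsRegular X xr) (w : G)
    (h : ∀ t k, traceCLM E (compAd E G (adMap E w) (adMap E (xr t) (X k))) = 0) (Y : E) :
    traceCLM E (compAd E G (adMap E w) Y) = 0 := by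
  have hY : Y ∈ Submodule.span ℝ
      {Y : E | ∃ (t : ℝ) (k : Fin m), Y = adMap E (xr t) (X k)} :=
    (Submodule.eq_top_iff'.1 hreg) Y
  induction hY using Submodule.span_induction with
  | mem Y hY =>
    obtain ⟨t, k, rfl⟩ := hY
    exact h t k
  | zero => simp
  | add Y Z _ _ hY hZ => rw [map_add, map_add, hY, hZ, add_zero]
  | smul c Y _ hY => rw [map_smul, map_smul, hY, smul_zero]

/-- Applying `dV` to W(t, w) = 0 gives ∑ₖ aₖ² = 0, so each aₖ vanishes without any linear
independence of the fields; regularity then covers all `Y`. -/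
theorem mem_criticalPoints_auxField_iff {m : ℕ} {X : Fin m → GroupLieAlgebra 𝓘(ℝ, E) G}
    {xr : ℝ → G} (hreg : IsRegular X xr) (w : G) :
    w ∈ criticalPoints (auxField X xr) ↔
      ∀ Y : E, traceCLM E (compAd E G (adMap E w) Y) = 0 := by
  constructor
  · intro hw
    refine hreg.forall_eq_zero w fun t k ↦ ?_
    have h : dV w (auxField X xr t w) = 0 := by rw [hw t]; exact map_zero _
    rw [auxField_eq, dV_mulInvariantVectorField, map_sum, map_sum] at h
    simp only [map_smul, smul_eq_mul, ← pow_two] at h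
    have := (Finset.sum_eq_zero_iff_of_nonneg fun k _ ↦ sq_nonneg _).1 h k (Finset.mem_univ k)
    exact pow_eq_zero_iff (two_ne_zero) |>.1 this
  · intro hw t
    rw [auxField_eq]
    simp only [hw, zero_smul, Finset.sum_const_zero]
    exact map_zero (modelDeriv E E (fun y ↦ w * y) 1)

-- The constant curve at a critical point is an integral curve.
omit [Group G] [LieGroup 𝓘(ℝ, E) ∞ G] [FiniteDimensional ℝ E] in
theorem criticalPoints_subset_omegaLimitPoints
    (F : ℝ → (x : G) → TangentSpace 𝓘(ℝ, E) x) : criticalPoints F ⊆ omegaLimitPoints F := by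
  intro w hw
  simp only [omegaLimitPoints, Set.mem_iUnion]
  refine ⟨0, w, fun _ ↦ w, fun t ↦ ?_, rfl, fun n ↦ n, Nat.strictMono_cast,
    tendsto_natCast_atTop_atTop, tendsto_const_nhds⟩
  have h0 : (1 : ℝ →L[ℝ] ℝ).smulRight (0 : TangentSpace 𝓘(ℝ, E) w) = 0 := by
    ext
    exact smul_zero (M := ℝ) (A := E) 1
  rw [hw t, h0]
  exact hasMFDerivAt_const w t

/-- The invariance principle: the `ω`-limit points of `W` are critical points of `V`. -/
theorem traceCLM_compAd_eq_zero_of_mem_omegaLimitPoints [CompactSpace G] {m : ℕ}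
    {X : Fin m → GroupLieAlgebra 𝓘(ℝ, E) G} {T : ℝ} {xr : ℝ → G} (hT : 0 < T)
    (hx : Continuous xr) (hxT : Function.Periodic xr T) (hreg : IsRegular X xr) {w : G}
    (hw : w ∈ omegaLimitPoints (auxField X xr)) (Y : E) :
    traceCLM E (compAd E G (adMap E w) Y) = 0 := by
  simp only [omegaLimitPoints, Set.mem_iUnion] at hw
  obtain ⟨-, -, γ, hγ, -, s, -, hs, hsw⟩ := hw
  refine hreg.forall_eq_zero w (fun t k ↦ ?_) Y
  refine eq_zero_of_tendsto_of_bounded (𝔤 := E) (compAd E G) (traceCLM E) hT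
    (Z := fun k t ↦ adMap E (xr t) (X k)) (A := fun t ↦ adMap E (γ t)) (fun k ↦ ?_) (fun k t ↦ ?_)
    ?_ (fun t ↦ hasDerivAt_adMap_comp hγ (auxField_eq X xr t (γ t))) hs
    ((continuous_adMap.tendsto w).comp hsw) k t
  · have h : ∀ v : E, Continuous fun t ↦ adMap E (xr t) v := fun v ↦
      (continuous_adMap.comp hx).clm_apply continuous_const
    exact h (X k)
  · simp only [hxT t]
  -- Boundedness of `A` comes from compactness of `Ad(G)`.
  · refine (isCompact_range (continuous_adMap (E := E) (G := G))).isBounded.subset ?_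
    exact Set.range_comp_subset_range γ (adMap E)

end LieGroup
end LieTracking

/-! ### The main theorem -/

open LieTracking in
theorem mainTheorem6
    {E : Type*} [NormedAddCommGroup E] [NormedSpace ℝ E] [FiniteDimensional ℝ E]
    {G : Type*} [TopologicalSpace G] [ChartedSpace E G] [Group G] [LieGroup 𝓘(ℝ, E) ∞ G]
    [T2Space G] [CompactSpace G] [ConnectedSpace G]
    {m : ℕ} (X : Fin m → GroupLieAlgebra 𝓘(ℝ, E) G)
    (T : ℝ) (xr : ℝ → G) (ur : Fin m → ℝ → ℝ)
    (hper : LieTracking.IsPeriodicTrajectory X T xr ur)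
    (hreg : LieTracking.IsRegular X xr) :
    (∀ w ∈ LieTracking.omegaLimitPoints (LieTracking.auxField X xr),
      (∀ Y : GroupLieAlgebra 𝓘(ℝ, E) G, LieTracking.trAdad w Y = 0) ∧
      (∀ Y : GroupLieAlgebra 𝓘(ℝ, E) G,
        LieTracking.dV w (mulInvariantVectorField Y w) = 0)) ∧
    LieTracking.criticalPoints (LieTracking.auxField X xr) =
      {w : G | ∀ Y : GroupLieAlgebra 𝓘(ℝ, E) G, LieTracking.trAdad w Y = 0} ∧
    LieTracking.criticalPoints (LieTracking.auxField X xr) =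
      LieTracking.omegaLimitPoints (LieTracking.auxField X xr) ∧
    LieTracking.criticalPoints (LieTracking.auxField X xr) =
      {w : G | (LieTracking.dV w : TangentSpace 𝓘(ℝ, E) w →L[ℝ] ℝ) = 0} := by
  have homega : ∀ w ∈ omegaLimitPoints (auxField X xr), ∀ Y : E,
      traceCLM E (compAd E G (adMap E w) Y) = 0 := fun w hw ↦
    traceCLM_compAd_eq_zero_of_mem_omegaLimitPoints hper.period_pos
      (continuous_of_isIntegralCurve hper.isIntegralCurve) hper.periodic_curve hreg hw
  have hcrit := mem_criticalPoints_auxField_iff hreg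
  refine ⟨fun w hw ↦ ⟨fun Y ↦ (trAdad_eq (E := E) w Y).trans (homega w hw Y),
    fun Y ↦ (dV_mulInvariantVectorField (E := E) w Y).trans (homega w hw Y)⟩, ?_, ?_, ?_⟩
  · ext w
    rw [hcrit w]
    exact forall_congr' fun Y ↦ by rw [← trAdad_eq]
  · exact (criticalPoints_subset_omegaLimitPoints _).antisymm
      fun w hw ↦ (hcrit w).2 (homega w hw)
  · ext w
    rw [hcrit w, Set.mem_ofPred_eq, dV_eq_zero_iff]
    exact forall_congr' fun Y ↦ by rw [← dV_mulInvariantVectorField]
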